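/- For $\lambda\in\mathbb{C}$ and $n\in\mathbb{N}_0$ let $(\lambda)_0=1$, $(\lambda)_n=\lambda(\lambda+1)\cdots(\lambda+n-1)$ for $n\ge 1$, let $\mathbb{Z}_0^-=\{0,-1,-2,\dots\}$, and write $$F^{1:1;2}_{1:0;1}\left[\begin{array}{rrr}\alpha:&\epsilon;&b_1,\,b_2;\\ \beta:&-;&d;\end{array}x,\,y\right]=\sum_{m=0}^{\infty}\sum_{n=0}^{\infty}\frac{(\alpha)_{m+n}\,(\epsilon)_m\,(b_1)_n\,(b_2)_n}{(\beta)_{m+n}\,(d)_n}\,\frac{x^m}{m!}\,\frac{y^n}{n!}$$ for the Kampé de Fériet function. **Theorem 2.** Let $i\in\mathbb{N}_0$ and $\alpha,\beta,\epsilon\in\mathbb{C}$ with $\beta\notin\mathbb{Z}_0^-$. (i) Suppose that $1+\alpha-\beta+\epsilon+i\notin\mathbb{Z}_0^-$. Then the double series below converges absolutely, and, provided that the arguments $\beta-\epsilon-i$ and $\epsilon-\beta+\frac{1+\alpha+i+r}{2}$ $(0\le r\le i)$ of the Gamma functions in the numerators on the right are not in $\mathbb{Z}_0^-$, $$F^{1:1;2}_{1:0;1}\left[\begin{array}{rrr}\alpha:&\epsilon;&\beta-\epsilon,\,1+\alpha-2\beta+\epsilon+i;\\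 \beta:&-;&1+\alpha-\beta+\epsilon+i;\end{array}\tfrac12,\,\tfrac12\right]$$ $$=\frac{2^{i+\alpha-2\beta+2\epsilon}\,\Gamma(\beta-\epsilon-i)\,\Gamma(1+\alpha-\beta+\epsilon+i)}{\Gamma(\beta-\epsilon)\,\Gamma(1+\alpha-2\beta+2\epsilon+i)}\sum_{r=0}^{i}(-1)^r\binom{i}{r}\frac{\Gamma\left(\epsilon-\beta+\frac{1+\alpha+i+r}{2}\right)}{\Gamma\left(\frac{1+\alpha-i+r}{2}\right)}.$$ (ii) Suppose that $1+\alpha-\beta+\epsilon-i\notin\mathbb{Z}_0^-$. Then the double series below converges absolutely, and, provided that the arguments $\epsilon-\beta+\frac{1+\alpha-i+r}{2}$ $(0\le r\le i)$ are not in $\mathbb{Z}_0^-$, $$F^{1:1;2}_{1:0;1}\left[\begin{array}{rrr}\alpha:&\epsilon;&\beta-\epsilon,\,1+\alpha-2\beta+\epsilon-i;\\ \beta:&-;&1+\alpha-\beta+\epsilon-i;\end{array}\tfrac12,\,\tfrac12\right]$$ $$=\frac{2^{-i+\alpha-2\beta+2\epsilon}\,\Gamma(1+\alpha-\beta+\epsilon-i)}{\Gamma(1+\alpha-2\beta+2\epsilon-i)}\sum_{r=0}^{i}\binom{i}{r}\frac{\Gamma\left(\epsilon-\beta+\frac{1+\alpha-i+r}{2}\right)}{\Gamma\left(\frac{1+\alpha-i+r}{2}\right)}.$$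 Here $2^z=e^{z\log 2}$, and $1/\Gamma$ is read as $0$ at the poles of $\Gamma$. -/

import Mathlib

/-- The product `(l₁)_n (l₂)_n ⋯ (l_L)_n` of Pochhammer symbols (rising factorials)
attached to a finite sequence of complex parameters; it is `1` for the empty sequence. -/
noncomputable def pochhammerProd (l : List ℂ) (n : ℕ) : ℂ :=
  (l.map fun z => (ascPochhammer ℂ n).eval z).prod

/-- The `(m, n)`-th term of the Kampé de Fériet double hypergeometric series
`F^{H:A;B}_{G:C;D}[(h):(a);(b); (g):(c);(d); x, y]`. -/
noncomputable def kampeDeFerietTerm (h a b g c d : List ℂ) (x y : ℂ) (m n : ℕ) : ℂ :=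
  (pochhammerProd h (m + n) * pochhammerProd a m * pochhammerProd b n) /
      (pochhammerProd g (m + n) * pochhammerProd c m * pochhammerProd d n) *
    (x ^ m / (m.factorial : ℂ)) * (y ^ n / (n.factorial : ℂ))

/-- The Kampé de Fériet function `F^{H:A;B}_{G:C;D}[(h):(a);(b); (g):(c);(d); x, y]`:
the sum over `m` of the sums over `n` of its terms. -/
noncomputable def kampeDeFeriet (h a b g c d : List ℂ) (x y : ℂ) : ℂ :=
  ∑' m : ℕ, ∑' n : ℕ, kampeDeFerietTerm h a b g c d x y m n

/-- `z` is not one of the nonpositive integers `0, -1, -2, …`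
(equivalently, not a pole of the Gamma function). -/
def NotNonposInt (z : ℂ) : Prop := ∀ k : ℕ, z ≠ -(k : ℂ)

/-! At equal arguments the double series, grouped by `m + n = N`, has the coefficients of `(1 -
z)^(-ε) ₂F₁(β - ε, b; β + b; z)` inside. Euler's transformation turns these into those of `₂F₁(β, b
+ ε; β + b; z)`; the factor `(β)_N` cancels, leaving `₂F₁(α, b + ε; d; 1/2)` with `d = β + b`
(`kampeDeFeriet_eq_regHyp`).

Here `d` differs by `± i/2` from the lower parameter of Gauss's second theorem (`regHyp_gauss`).
That theorem comes from a quadratic substitution in a Beta integral, extended to all parameters by a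
recurrence. Contiguous relations then move the lower parameter in half-integer steps, and Pascal's
rule collects the results into binomial sums (`regHyp_gauss_sub`, `regHyp_gauss_add`). Dividing the
series by `Γ(c)` keeps these relations valid for every `c`. -/

open Filter Topology

/-! ### Rising factorials and their growth -/

/-- The rising factorial `(a)_n`. -/
noncomputable def poch (a : ℂ) (n : ℕ) : ℂ := (ascPochhammer ℂ n).eval a

@[simp] lemma poch_zero (a : ℂ) : poch a 0 = 1 := by simp [poch]

lemma poch_succ (a : ℂ) (n : ℕ) : poch a (n + 1) = poch a n * (a + n) :=
  ascPochhammer_succ_eval n a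

lemma poch_succ_left (a : ℂ) (n : ℕ) : poch a (n + 1) = a * poch (a + 1) n := by
  simp [poch, ascPochhammer_succ_left, Polynomial.eval_comp]

lemma poch_one (n : ℕ) : poch 1 n = n.factorial := ascPochhammer_eval_one ℂ n

lemma NotNonposInt.add_nat_ne_zero {a : ℂ} (h : NotNonposInt a) (n : ℕ) : a + n ≠ 0 :=
  fun h0 => h n (eq_neg_of_add_eq_zero_left h0)

lemma NotNonposInt.add_nat {a : ℂ} (h : NotNonposInt a) (n : ℕ) : NotNonposInt (a + n) :=
  fun k hk => h (n + k) (by push_cast; linear_combination hk)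

lemma NotNonposInt.poch_ne_zero {a : ℂ} (h : NotNonposInt a) (n : ℕ) : poch a n ≠ 0 := by
  induction n with
  | zero => simp
  | succ n ih => rw [poch_succ]; exact mul_ne_zero ih (h.add_nat_ne_zero n)

lemma NotNonposInt.Gamma_ne_zero {a : ℂ} (h : NotNonposInt a) : Complex.Gamma a ≠ 0 :=
  Complex.Gamma_ne_zero h

lemma notNonposInt_one : NotNonposInt 1 := fun k hk => by
  have : (1 : ℝ) = -(k : ℝ) := by exact_mod_cast congrArg Complex.re hk
  linarith [(Nat.cast_nonneg k : (0 : ℝ) ≤ k)]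

lemma NotNonposInt.of_re_pos {a : ℂ} (h : 0 < a.re) : NotNonposInt a := fun k hk => by
  rw [hk] at h
  simp at h
  linarith [(Nat.cast_nonneg k : (0 : ℝ) ≤ k)]

lemma tendsto_add_nat_div_add_nat (a b : ℂ) :
    Tendsto (fun k : ℕ => (a + k) / (b + k)) atTop (𝓝 1) := by
  simpa using tendsto_add_mul_div_add_mul_atTop_nhds a b (1 : ℂ) one_ne_zero

lemma eventually_add_nat_ne_zero (b : ℂ) : ∀ᶠ k : ℕ in atTop, b + k ≠ 0 := by
  by_cases h : NotNonposInt b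
  · exact Eventually.of_forall h.add_nat_ne_zero
  · simp only [NotNonposInt, not_forall, not_not] at h
    obtain ⟨m, rfl⟩ := h
    filter_upwards [eventually_gt_atTop m] with k hk h0
    have : (k : ℂ) = m := by linear_combination h0
    exact hk.ne' (by exact_mod_cast this)

/-- Quotients of rising factorials grow more slowly than every exponential. -/
lemma exists_norm_poch_div_le (a b : ℂ) {ρ : ℝ} (hρ : 1 < ρ) :
    ∃ C : ℝ, 0 ≤ C ∧ ∀ n, ‖poch a n / poch b n‖ ≤ C * ρ ^ n := by
  set u : ℕ → ℂ := fun n => poch a n / poch b n / (ρ : ℂ) ^ n with hu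
  have hρ0 : (0 : ℝ) < ρ := by linarith
  have hs : Summable u := by
    obtain ⟨σ, h1, h2⟩ := exists_between hρ
    refine summable_of_ratio_norm_eventually_le (r := σ / ρ) ((div_lt_one hρ0).2 h2) ?_
    have ht := (tendsto_add_nat_div_add_nat a b).norm
    rw [norm_one] at ht
    filter_upwards [ht.eventually_lt_const h1] with n hn
    -- This also holds when `b + n = 0`, both sides being `0` under `x / 0 = 0`, so `b` is
    -- unrestricted.
    have : u (n + 1) = ((a + n) / (b + n)) * u n / ρ := by
      simp only [hu, poch_succ, pow_succ]
      simp only [div_eq_mul_inv, mul_inv]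
      ring
    rw [this, norm_div, norm_mul, Complex.norm_real, Real.norm_of_nonneg hρ0.le,
      div_mul_eq_mul_div]
    gcongr
  obtain ⟨C, hC⟩ := (Metric.isBounded_range_of_tendsto u hs.tendsto_atTop_zero).exists_norm_le
  refine ⟨C, (norm_nonneg _).trans (hC (u 0) ⟨0, rfl⟩), fun n => ?_⟩
  have := hC (u n) ⟨n, rfl⟩
  simp only [hu] at this
  rwa [norm_div, norm_pow, Complex.norm_real, Real.norm_of_nonneg hρ0.le,
    div_le_iff₀ (by positivity)] at this

/-! ### The regularised Gauss series at 1/2 and its contiguous relations -/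

/-- The terms of the regularised Gauss series `₂F₁(a, b; c; 1/2) / Γ(c)`. -/
noncomputable def regTerm (a b c : ℂ) (k : ℕ) : ℂ :=
  poch a k * poch b k * (Complex.Gamma (c + k))⁻¹ / k.factorial * (1 / 2) ^ k

/-- The regularised Gauss function `₂F₁(a, b; c; 1/2) / Γ(c)`, an entire function of `c`. -/
noncomputable def regHyp (a b c : ℂ) : ℂ := ∑' k, regTerm a b c k

lemma inv_Gamma_eq (s : ℂ) : (Complex.Gamma s)⁻¹ = s * (Complex.Gamma (s + 1))⁻¹ :=
  Complex.one_div_Gamma_eq_self_mul_one_div_Gamma_add_one s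

lemma summable_regTerm (a b c : ℂ) : Summable (regTerm a b c) := by
  refine summable_of_ratio_norm_eventually_le (r := 3 / 4) (by norm_num) ?_
  have h := (((tendsto_add_nat_div_add_nat a c).mul (tendsto_add_nat_div_add_nat b 1)).div_const
    2).norm
  have h1 : ‖(1 : ℂ) * 1 / 2‖ < 3 / 4 := by norm_num
  filter_upwards [h.eventually_lt_const h1, eventually_add_nat_ne_zero c] with k hk hc
  have : regTerm a b c (k + 1) = (a + k) / (c + k) * ((b + k) / (1 + k)) / 2 * regTerm a b c k := by
    have h1 : (1 + k : ℂ) ≠ 0 := notNonposInt_one.add_nat_ne_zero k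
    have h2 : (k.factorial : ℂ) ≠ 0 := by exact_mod_cast k.factorial_ne_zero
    simp only [regTerm, poch_succ, inv_Gamma_eq (c + k), Nat.factorial_succ, pow_succ]
    push_cast
    rw [← add_assoc c, add_comm (k : ℂ) 1]
    field_simp
  rw [this, norm_mul]
  gcongr

lemma regTerm_comm (a b c : ℂ) (k : ℕ) : regTerm a b c k = regTerm b a c k := by
  simp only [regTerm, mul_comm (poch a k)]

lemma regHyp_comm (a b c : ℂ) : regHyp a b c = regHyp b a c :=
  tsum_congr (regTerm_comm a b c)

lemma regHyp_eq_zero_add (a b c : ℂ) :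
    regHyp a b c = regTerm a b c 0 + ∑' k, regTerm a b c (k + 1) :=
  (summable_regTerm a b c).tsum_eq_zero_add

lemma summable_regTerm_succ (a b c : ℂ) : Summable fun k => regTerm a b c (k + 1) :=
  (summable_nat_add_iff 1).2 (summable_regTerm a b c)

/-- Termwise this is `(a+1)_k - (a)_k = k (a+1)_(k-1)`, followed by a shift of the index. -/
lemma regHyp_sub_lower (a b c : ℂ) :
    regHyp (a + 1) b c - regHyp a b c = b / 2 * regHyp (a + 1) (b + 1) (c + 1) := by
  rw [regHyp_eq_zero_add (a + 1), regHyp_eq_zero_add a, add_sub_add_comm,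
    ← (summable_regTerm_succ _ _ _).tsum_sub (summable_regTerm_succ _ _ _)]
  have h0 : regTerm (a + 1) b c 0 - regTerm a b c 0 = 0 := by simp [regTerm]
  rw [h0, zero_add, regHyp, ← tsum_mul_left]
  refine tsum_congr fun k => ?_
  have h1 : (k + 1 : ℂ) ≠ 0 := by exact_mod_cast k.succ_ne_zero
  have h2 : (k.factorial : ℂ) ≠ 0 := by exact_mod_cast k.factorial_ne_zero
  simp only [regTerm]
  rw [poch_succ_left a, poch_succ_left b, poch_succ, Nat.factorial_succ, pow_succ]
  push_cast
  rw [show c + (k + 1) = c + 1 + k by ring]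
  field_simp
  ring

lemma regHyp_mul_sub (a b c : ℂ) :
    (c - b) * regHyp a b (c + 1) = regHyp a b c - b * regHyp a (b + 1) (c + 1) := by
  rw [regHyp, regHyp, regHyp, ← tsum_mul_left, ← tsum_mul_left,
    ← (summable_regTerm _ _ _).tsum_sub ((summable_regTerm _ _ _).mul_left b)]
  refine tsum_congr fun k => ?_
  simp only [regTerm]
  have := (poch_succ_left b k).symm.trans (poch_succ b k)
  rw [inv_Gamma_eq (c + k), show c + k + 1 = c + 1 + k by ring]
  linear_combination poch a k * (Complex.Gamma (c + 1 + k))⁻¹ / k.factorial * (1 / 2) ^ k * this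

/-- The recurrence in `a` behind Gauss's second summation theorem. -/
lemma regHyp_gauss_add_two {a b c : ℂ} (hc : 2 * c = a + b + 1) :
    regHyp a b c = (a + 1) / 2 * regHyp (a + 2) b (c + 1) := by
  rw [← sub_eq_zero, regHyp_eq_zero_add a, regHyp_eq_zero_add (a + 2), mul_add, add_sub_add_comm,
    ← tsum_mul_left, ← (summable_regTerm_succ _ _ _).tsum_sub
      ((summable_regTerm_succ _ _ _).mul_left _)]
  -- The difference telescopes: it is a multiple of consecutive differences of the series with all
  -- parameters raised by one. The boundary term is `h0`, so the total is zero.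
  have key : ∀ k, regTerm a b c (k + 1) - (a + 1) / 2 * regTerm (a + 2) b (c + 1) (k + 1) =
      b / 2 * (regTerm (a + 1) (b + 1) (c + 1) (k + 1) - regTerm (a + 1) (b + 1) (c + 1) k) := by
    intro k
    have h1 : (k + 1 : ℂ) ≠ 0 := by exact_mod_cast k.succ_ne_zero
    have h2 : (k.factorial : ℂ) ≠ 0 := by exact_mod_cast k.factorial_ne_zero
    have h3 : (a + 1) * poch (a + 2) (k + 1) = poch (a + 1) k * (a + 1 + k) * (a + 1 + (k + 1)) := by
      have := poch_succ_left (a + 1) (k + 1)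
      rw [show a + 1 + 1 = a + 2 by ring] at this
      rw [← this, poch_succ, poch_succ]
      push_cast; ring
    have h4 : regTerm (a + 2) b (c + 1) (k + 1) * (a + 1) = poch (a + 1) k * (a + 1 + k) *
        (a + 1 + (k + 1)) * poch b (k + 1) * (Complex.Gamma (c + 1 + (k + 1)))⁻¹ /
          (k + 1).factorial * (1 / 2) ^ (k + 1) := by
      rw [← h3, regTerm]; push_cast; ring
    rw [div_mul_eq_mul_div, mul_comm (a + 1), h4]
    simp only [regTerm]
    rw [poch_succ_left a, poch_succ_left b, poch_succ (a + 1), poch_succ (b + 1),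
      Nat.factorial_succ, pow_succ]
    push_cast
    rw [show c + (k + 1) = c + 1 + k by ring, inv_Gamma_eq (c + 1 + k),
      show c + 1 + k + 1 = c + 1 + (k + 1) by ring]
    obtain rfl : b = 2 * c - a - 1 := by linear_combination -hc
    field_simp
    ring
  have h0 : regTerm a b c 0 - (a + 1) / 2 * regTerm (a + 2) b (c + 1) 0 =
      b / 2 * regTerm (a + 1) (b + 1) (c + 1) 0 := by
    simp only [regTerm, poch_zero, Nat.cast_zero, add_zero]
    rw [inv_Gamma_eq c]
    linear_combination (Complex.Gamma (c + 1))⁻¹ * hc / 2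
  simp only [key]
  rw [tsum_mul_left, (summable_regTerm_succ _ _ _).tsum_sub (summable_regTerm _ _ _), h0]
  have := regHyp_eq_zero_add (a + 1) (b + 1) (c + 1)
  rw [regHyp] at this
  rw [this]
  ring

/-! ### Euler's transformation on coefficients -/

/-- The coefficient comparison in Euler's transformation
`(1 - z)⁻ᵉ ₂F₁(a, b; a + b + e; z) = ₂F₁(a + e, b + e; a + b + e; z)`. -/
lemma euler_partial_sum (a b e : ℂ) (hd : NotNonposInt (a + b + e)) (k j : ℕ) :
    ∑ n ∈ Finset.range k,
      ((k + j : ℂ) * (a + b + e + (k + j - 1)) * (poch e (k + j - n) / (k + j - n).factorial) -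
        (a + e + (k + j - 1)) * (b + e + (k + j - 1)) *
          (poch e (k + j - 1 - n) / (k + j - 1 - n).factorial)) *
        (poch a n * poch b n / (poch (a + b + e) n * n.factorial)) =
      -(poch e j / j.factorial) * k * (a + b + e + (k - 1)) *
        (poch a k * poch b k / (poch (a + b + e) k * k.factorial)) := by
  -- The order `k + j` of the coefficient stays fixed while the partial sum grows, so `(k + 1, j)`
  -- rests on `(k, j + 1)`.
  induction k generalizing j with
  | zero => simp
  | succ k ih =>
    rw [Finset.sum_range_succ]
    have h := ih (j + 1)
    push_cast at h ⊢
    rw [show k + (j + 1) = k + 1 + j by ring, show (k : ℂ) + (j + 1) = k + 1 + j by ring] at h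
    rw [h, show k + 1 + j - k = j + 1 by omega, show k + 1 + j - 1 - k = j by omega]
    have h1 : (k + 1 : ℂ) ≠ 0 := by exact_mod_cast k.succ_ne_zero
    have h2 : (k.factorial : ℂ) ≠ 0 := by exact_mod_cast k.factorial_ne_zero
    have h3 : (j + 1 : ℂ) ≠ 0 := by exact_mod_cast j.succ_ne_zero
    have h4 : (j.factorial : ℂ) ≠ 0 := by exact_mod_cast j.factorial_ne_zero
    have h5 := hd.poch_ne_zero k
    have h6 := hd.add_nat_ne_zero k
    simp only [poch_succ, Nat.factorial_succ]
    push_cast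
    field_simp
    ring

/-- At `j = 0` the closed partial sum is minus the missing term `n = N + 1`. This gives the
convolution the same first-order recurrence as the coefficients of the transformed series. -/
lemma euler_coeff_succ (a b e : ℂ) (hd : NotNonposInt (a + b + e)) (N : ℕ) :
    (N + 1 : ℂ) * (a + b + e + N) * ∑ n ∈ Finset.range (N + 2),
        poch e (N + 1 - n) / (N + 1 - n).factorial *
          (poch a n * poch b n / (poch (a + b + e) n * n.factorial)) =
      (a + e + N) * (b + e + N) * ∑ n ∈ Finset.range (N + 1),
        poch e (N - n) / (N - n).factorial *
          (poch a n * poch b n / (poch (a + b + e) n * n.factorial)) := by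
  have h := euler_partial_sum a b e hd (N + 1) 0
  simp only [sub_mul, Finset.sum_sub_distrib, mul_assoc, ← Finset.mul_sum] at h
  rw [Finset.sum_range_succ _ (N + 1)]
  simp only [add_zero, Nat.add_sub_cancel, Nat.cast_add, Nat.cast_one, add_sub_cancel_right,
    Nat.cast_zero, poch_zero, Nat.factorial_zero, Nat.sub_self] at h ⊢
  linear_combination h

lemma euler_coeff (a b e : ℂ) (hd : NotNonposInt (a + b + e)) (N : ℕ) :
    ∑ n ∈ Finset.range (N + 1), poch e (N - n) / (N - n).factorial *
          (poch a n * poch b n / (poch (a + b + e) n * n.factorial)) =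
      poch (a + e) N * poch (b + e) N / (poch (a + b + e) N * N.factorial) := by
  induction N with
  | zero => simp
  | succ N ih =>
    have h := euler_coeff_succ a b e hd N
    rw [ih] at h
    have h1 : (N + 1 : ℂ) ≠ 0 := by exact_mod_cast N.succ_ne_zero
    have h2 : (N.factorial : ℂ) ≠ 0 := by exact_mod_cast N.factorial_ne_zero
    have h5 := hd.poch_ne_zero N
    have h6 := hd.add_nat_ne_zero N
    apply mul_left_cancel₀ (mul_ne_zero h1 h6)
    rw [h]
    simp only [poch_succ, Nat.factorial_succ]
    push_cast
    field_simp

/-! ### Convergence and reduction of the double series -/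

lemma kampeDeFerietTerm_eq (α β ε b₁ b₂ d : ℂ) (x y : ℂ) (m n : ℕ) :
    kampeDeFerietTerm [α] [ε] [b₁, b₂] [β] [] [d] x y m n =
      poch α (m + n) / poch β (m + n) * (poch ε m / m.factorial) *
        (poch b₁ n * poch b₂ n / (poch d n * n.factorial)) * (x ^ m * y ^ n) := by
  simp only [kampeDeFerietTerm, pochhammerProd, poch, List.map_cons, List.map_nil, List.prod_cons,
    List.prod_nil, mul_one, div_eq_mul_inv, mul_inv]
  ring

lemma summable_kampeDeFerietTerm (α β ε b₁ b₂ d : ℂ) :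
    Summable fun p : ℕ × ℕ =>
      kampeDeFerietTerm [α] [ε] [b₁, b₂] [β] [] [d] (1 / 2) (1 / 2) p.1 p.2 := by
  -- At most three quotients grow with either index, and `(11/10)^3 / 2 < 1`.
  have hρ : (1 : ℝ) < 11 / 10 := by norm_num
  obtain ⟨A, hA0, hA⟩ := exists_norm_poch_div_le α β hρ
  obtain ⟨B, hB0, hB⟩ := exists_norm_poch_div_le ε 1 hρ
  obtain ⟨C, hC0, hC⟩ := exists_norm_poch_div_le b₁ d hρ
  obtain ⟨D, hD0, hD⟩ := exists_norm_poch_div_le b₂ 1 hρ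
  simp only [poch_one] at hB hD
  set σ : ℝ := (11 / 10) ^ 3 * (1 / 2) with hσ
  have hg : Summable fun n : ℕ => σ ^ n :=
    summable_geometric_of_lt_one (by positivity) (by norm_num [hσ])
  refine Summable.of_norm_bounded
    (((hg.mul_of_nonneg hg (fun n => by positivity) (fun n => by positivity))).mul_left
      (A * B * (C * D))) fun p => ?_
  obtain ⟨m, n⟩ := p
  rw [kampeDeFerietTerm_eq, mul_div_mul_comm]
  simp only [norm_mul, norm_pow]
  have h2 : ‖(1 / 2 : ℂ)‖ = 1 / 2 := by norm_num
  rw [h2]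
  have hmn : (11 / 10 : ℝ) ^ m ≤ ((11 / 10) ^ m) ^ 2 :=
    le_self_pow₀ (one_le_pow₀ hρ.le) two_ne_zero
  calc _ ≤ A * (11 / 10) ^ (m + n) * (B * (11 / 10) ^ m) *
        ((C * (11 / 10) ^ n) * (D * (11 / 10) ^ n)) * ((1 / 2) ^ m * (1 / 2) ^ n) := by
        gcongr
        exacts [hA _, hB _, hC _, hD _]
    _ = A * B * (C * D) * ((11 / 10) ^ m * (11 / 10) ^ m * ((11 / 10) ^ 3) ^ n) *
        ((1 / 2) ^ m * (1 / 2) ^ n) := by rw [pow_add, ← pow_mul, mul_comm 3 n, pow_mul]; ring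
    _ ≤ A * B * (C * D) * ((11 / 10) ^ m * ((11 / 10) ^ m) ^ 2 * ((11 / 10) ^ 3) ^ n) *
        ((1 / 2) ^ m * (1 / 2) ^ n) := by gcongr
    _ = A * B * (C * D) * (σ ^ m * σ ^ n) := by
        rw [hσ, mul_pow, mul_pow, ← pow_succ', ← pow_mul, mul_comm m, pow_mul]; ring

/-- Reduction of the double series at equal arguments to a Gauss series. -/
lemma kampeDeFeriet_eq_regHyp {α β ε b d : ℂ} (hβ : NotNonposInt β) (hd : NotNonposInt d)
    (h : d = β + b) :
    kampeDeFeriet [α] [ε] [β - ε, b] [β] [] [d] (1 / 2) (1 / 2) =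
      Complex.Gamma d * regHyp α (b + ε) d := by
  have hs := summable_kampeDeFerietTerm α β ε (β - ε) b d
  have hs' := Finset.HasAntidiagonal.sigmaAntidiagonalEquivProd.summable_iff.2 hs
  simp only [Function.comp_def] at hs'
  rw [kampeDeFeriet, ← hs.tsum_prod,
    ← Finset.HasAntidiagonal.sigmaAntidiagonalEquivProd.tsum_eq, hs'.tsum_sigma,
    regHyp, ← tsum_mul_left]
  refine tsum_congr fun N => ?_
  rw [tsum_fintype]
  simp only [Finset.HasAntidiagonal.sigmaAntidiagonalEquivProd_apply]
  rw [Finset.sum_coe_sort (Finset.HasAntidiagonal.antidiagonal N) fun p : ℕ × ℕ =>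
      kampeDeFerietTerm [α] [ε] [β - ε, b] [β] [] [d] (1 / 2) (1 / 2) p.1 p.2,
    ← Finset.Nat.sum_antidiagonal_swap, Finset.Nat.sum_antidiagonal_eq_sum_range_succ_mk]
  have hde : β - ε + b + ε = d := by rw [h]; ring
  -- The upper parameters become `(β - ε) + ε = β` and `b + ε`; `(β)_N` then cancels.
  have key := euler_coeff (β - ε) b ε (by rwa [hde]) N
  rw [hde, sub_add_cancel] at key
  have hG : poch d N * (Complex.Gamma (d + N))⁻¹ = (Complex.Gamma d)⁻¹ := by
    clear key hde
    induction N with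
    | zero => simp
    | succ N ih =>
      rw [← ih, poch_succ, inv_Gamma_eq (d + N)]
      push_cast
      rw [add_assoc d]; ring
  have hterm : ∀ n ∈ Finset.range (N + 1),
      kampeDeFerietTerm [α] [ε] [β - ε, b] [β] [] [d] (1 / 2) (1 / 2) (N - n) n =
      poch α N / poch β N * (1 / 2) ^ N * (poch ε (N - n) / (N - n).factorial *
          (poch (β - ε) n * poch b n / (poch d n * n.factorial))) := by
    intro n hn
    have hn' : N - n + n = N := Nat.sub_add_cancel (Nat.lt_succ_iff.1 (Finset.mem_range.1 hn))
    rw [kampeDeFerietTerm_eq, ← pow_add, hn']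
    ring
  simp only [Prod.fst_swap, Prod.snd_swap]
  rw [Finset.sum_congr rfl hterm, ← Finset.mul_sum, key, regTerm]
  have h1 := hβ.poch_ne_zero N
  have h2 := hd.poch_ne_zero N
  have h3 := hd.Gamma_ne_zero
  have h4 := (hd.add_nat N).Gamma_ne_zero
  have h5 : (N.factorial : ℂ) ≠ 0 := by exact_mod_cast N.factorial_ne_zero
  field_simp at hG ⊢
  linear_combination -(poch α N * poch (b + ε) N) * hG

/-! ### Gauss's second summation theorem -/

open MeasureTheory Set in
lemma integral_Ioo_subst_sq (g : ℝ → ℂ) :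
    ∫ v in Ioo (0 : ℝ) 1, g v =
      ∫ t in Ioo (0 : ℝ) 1, (4 * t / (2 - t) ^ 3) • g ((t / (2 - t)) ^ 2) := by
  have himg : (fun t : ℝ => (t / (2 - t)) ^ 2) '' Ioo 0 1 = Ioo 0 1 := by
    ext v
    constructor
    · rintro ⟨t, ⟨h0, h1⟩, rfl⟩
      have h2 : 0 < t / (2 - t) := div_pos h0 (by linarith)
      have h3 : t / (2 - t) < 1 := (div_lt_one (by linarith)).2 (by linarith)
      exact ⟨by positivity, pow_lt_one₀ h2.le h3 two_ne_zero⟩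
    · rintro ⟨h0, h1⟩
      have hs : 0 < √v := Real.sqrt_pos.2 h0
      have hs1 : √v < 1 := by rwa [Real.sqrt_lt' one_pos, one_pow]
      refine ⟨2 * √v / (1 + √v), ⟨by positivity, (div_lt_one (by positivity)).2 (by linarith)⟩, ?_⟩
      have : 2 * √v / (1 + √v) / (2 - 2 * √v / (1 + √v)) = √v := by
        have h : (2 - 2 * √v / (1 + √v)) = 2 / (1 + √v) := by field_simp; ring
        rw [h]; field_simp
      simp only [this, Real.sq_sqrt h0.le]
  have hinj : InjOn (fun t : ℝ => (t / (2 - t)) ^ 2) (Ioo 0 1) := by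
    rintro x ⟨hx0, hx1⟩ y ⟨hy0, hy1⟩ hxy
    have hx : 0 < 2 - x := by linarith
    have hy : 0 < 2 - y := by linarith
    have := (sq_eq_sq₀ (div_nonneg hx0.le hx.le) (div_nonneg hy0.le hy.le)).1 hxy
    rw [div_eq_div_iff hx.ne' hy.ne'] at this
    linarith
  have hder : ∀ t ∈ Ioo (0 : ℝ) 1, HasDerivWithinAt (fun t : ℝ => (t / (2 - t)) ^ 2)
      (4 * t / (2 - t) ^ 3) (Ioo 0 1) t := by
    rintro t ⟨h0, h1⟩
    have h2 : 2 - t ≠ 0 := by linarith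
    refine HasDerivAt.hasDerivWithinAt ?_
    convert! ((hasDerivAt_id t).div ((hasDerivAt_id t).const_sub 2) h2).pow 2 using 1
    simp only [id, Pi.div_apply, Nat.add_one_sub_one, pow_one, Nat.cast_ofNat]
    field_simp
    ring
  conv_lhs => rw [← himg]
  rw [integral_image_eq_integral_abs_deriv_smul measurableSet_Ioo hder hinj]
  refine setIntegral_congr_fun measurableSet_Ioo ?_
  rintro t ⟨h0, h1⟩
  have h2 : 0 < 2 - t := by linarith
  simp only
  rw [abs_of_nonneg (by positivity)]

lemma ofReal_cpow_eq_exp {x : ℝ} (hx : 0 < x) (w : ℂ) :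
    (x : ℂ) ^ w = Complex.exp (Real.log x * w) := by
  rw [Complex.cpow_def_of_ne_zero (by exact_mod_cast hx.ne'), Complex.ofReal_log hx.le]

-- With `v = (t / (2 - t))²` one has `1 - v = 4 (1 - t) / (2 - t)²`, so the integrand of `B(b/2, s)`
-- becomes Euler's integrand at `1/2` with `a = 2s + b - 1`. All bases are positive, so the identity
-- is linear in logarithms.
open Set in
lemma gauss_integrand_eq {b s : ℂ} {t : ℝ} (ht : t ∈ Ioo (0 : ℝ) 1) :
    (4 * t / (2 - t) ^ 3) • ((((t / (2 - t)) ^ 2 : ℝ) : ℂ) ^ (b / 2 - 1) *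
        (1 - (((t / (2 - t)) ^ 2 : ℝ) : ℂ)) ^ (s - 1)) =
      (2 : ℂ) ^ (1 - b) * ((t : ℂ) ^ (b - 1) * (1 - (t : ℂ)) ^ (s - 1) *
        (1 - (t : ℂ) / 2) ^ (-(2 * s + b - 1))) := by
  obtain ⟨h0, h1⟩ := ht
  have h2 : 0 < 2 - t := by linarith
  have h3 : 0 < 1 - t := by linarith
  have e1 : (1 : ℂ) - (((t / (2 - t)) ^ 2 : ℝ) : ℂ) =
      ((2 ^ 2 * (1 - t) / (2 - t) ^ 2 : ℝ) : ℂ) := by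
    rw [← Complex.ofReal_one, ← Complex.ofReal_sub]
    congr 1
    field_simp
    ring
  have e2 : (1 : ℂ) - (t : ℂ) = ((1 - t : ℝ) : ℂ) := by push_cast; rfl
  have e3 : (1 : ℂ) - (t : ℂ) / 2 = (((2 - t) / 2 : ℝ) : ℂ) := by push_cast; ring
  have e4 : (((4 * t / (2 - t) ^ 3 : ℝ)) : ℂ) =
      Complex.exp ((2 * Real.log 2 + Real.log t - 3 * Real.log (2 - t) : ℝ) : ℂ) := by
    rw [← Complex.ofReal_exp]
    congr 1
    rw [← Real.exp_log (show 0 < 4 * t / (2 - t) ^ 3 by positivity),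
      Real.log_div (by positivity) (by positivity), Real.log_mul (by norm_num) h0.ne', Real.log_pow,
      show (4 : ℝ) = 2 ^ 2 by norm_num, Real.log_pow]
    norm_num
  rw [Complex.real_smul, e1, e2, e3, e4, ← Complex.ofReal_ofNat 2, ofReal_cpow_eq_exp (by positivity),
    ofReal_cpow_eq_exp (by positivity), ofReal_cpow_eq_exp two_pos, ofReal_cpow_eq_exp h0,
    ofReal_cpow_eq_exp h3, ofReal_cpow_eq_exp (by positivity), ← Complex.exp_add,
    ← Complex.exp_add, ← Complex.exp_add, ← Complex.exp_add, ← Complex.exp_add,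
    Real.log_pow, Real.log_div h0.ne' h2.ne', Real.log_div (by positivity) (by positivity),
    Real.log_mul (by positivity) h3.ne', Real.log_pow, Real.log_pow, Real.log_div h2.ne' two_ne_zero]
  congr 1
  push_cast
  ring

lemma hasSum_binomial (a : ℂ) {z : ℂ} (hz : ‖z‖ < 1) :
    HasSum (fun k => poch a k / k.factorial * z ^ k) ((1 - z) ^ (-a)) := by
  have h := (Complex.one_div_one_sub_cpow_hasFPowerSeriesOnBall_zero a).hasSum (y := z)
    (by rw [← ENNReal.ofReal_one, Metric.eball_ofReal]; simpa using hz)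
  rw [zero_add, one_div, ← Complex.cpow_neg] at h
  convert! h using 2 with k
  rw [FormalMultilinearSeries.ofScalars_apply_eq, smul_eq_mul, ← Ring.multichoose_eq]
  have := Ring.factorial_nsmul_multichoose_eq_ascPochhammer a k
  rw [Polynomial.ascPochhammer_smeval_eq_eval, nsmul_eq_mul] at this
  rw [poch, ← this, mul_div_cancel_left₀ _ (by exact_mod_cast k.factorial_ne_zero)]

open MeasureTheory Set in
lemma betaIntegral_eq_Ioo (u v : ℂ) : Complex.betaIntegral u v =
    ∫ t in Ioo (0 : ℝ) 1, (t : ℂ) ^ (u - 1) * (1 - (t : ℂ)) ^ (v - 1) := by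
  rw [Complex.betaIntegral, intervalIntegral.integral_of_le zero_le_one,
    integral_Ioc_eq_integral_Ioo]

open MeasureTheory Set in
lemma integrableOn_beta {u v : ℂ} (hu : 0 < u.re) (hv : 0 < v.re) :
    IntegrableOn (fun t : ℝ => (t : ℂ) ^ (u - 1) * (1 - (t : ℂ)) ^ (v - 1)) (Ioo 0 1) :=
  ((intervalIntegrable_iff_integrableOn_Ioc_of_le zero_le_one).1
    (Complex.betaIntegral_convergent hu hv)).mono_set Ioo_subset_Ioc_self

lemma Gamma_add_nat_eq {b : ℂ} (hb : 0 < b.re) (k : ℕ) :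
    Complex.Gamma (b + k) = poch b k * Complex.Gamma b := by
  induction k with
  | zero => simp
  | succ k ih =>
    have := (NotNonposInt.of_re_pos hb).add_nat_ne_zero k
    push_cast
    rw [← add_assoc, Complex.Gamma_add_one _ this, ih, poch_succ]
    ring

open MeasureTheory Set in
/-- Euler's integral for `₂F₁(a, b; b + s; 1/2)`. -/
lemma hasSum_euler_integral (a : ℂ) {b s : ℂ} (hb : 0 < b.re) (hs : 0 < s.re) :
    HasSum (fun k => poch a k / k.factorial * (1 / 2) ^ k * Complex.betaIntegral (b + k) s)
      (∫ t in Ioo (0 : ℝ) 1, (t : ℂ) ^ (b - 1) * (1 - (t : ℂ)) ^ (s - 1) *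
        (1 - (t : ℂ) / 2) ^ (-a)) := by
  set c : ℕ → ℂ := fun k => poch a k / k.factorial * (1 / 2) ^ k with hc
  have hcs : Summable fun k => ‖c k‖ := by
    have := (hasSum_binomial a (z := 1 / 2) (by norm_num)).summable
    exact this.norm
  have hbk : ∀ k : ℕ, 0 < (b + k).re := fun k => by simp; positivity
  have hF : ∀ k, Integrable (fun t : ℝ => c k * ((t : ℂ) ^ (b + k - 1) * (1 - (t : ℂ)) ^ (s - 1)))
      (volume.restrict (Ioo 0 1)) := fun k => (integrableOn_beta (hbk k) hs).const_mul (c k)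
  have hpt : ∀ k : ℕ, ∀ t ∈ Ioo (0 : ℝ) 1, (t : ℂ) ^ (b + k - 1) = (t : ℂ) ^ (b - 1) * t ^ k := by
    rintro k t ⟨h0, -⟩
    rw [add_sub_right_comm, Complex.cpow_add _ _ (by exact_mod_cast h0.ne'), Complex.cpow_natCast]
  -- Since `t ^ k ≤ 1`, each integral is at most `‖c k‖` times a fixed Beta-type integral.
  have hnorm : Summable fun k => ∫ t in Ioo (0 : ℝ) 1,
      ‖c k * ((t : ℂ) ^ (b + k - 1) * (1 - (t : ℂ)) ^ (s - 1))‖ := by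
    refine Summable.of_nonneg_of_le (fun k => integral_nonneg fun t => norm_nonneg _) (fun k => ?_)
      (hcs.mul_right (∫ t in Ioo (0 : ℝ) 1, ‖(t : ℂ) ^ (b - 1) * (1 - (t : ℂ)) ^ (s - 1)‖))
    rw [← integral_const_mul]
    refine setIntegral_mono_on (hF k).norm ((integrableOn_beta hb hs).norm.const_mul _)
      measurableSet_Ioo fun t ht => ?_
    rw [hpt k t ht, mul_right_comm _ _ (_ ^ (s - 1)), norm_mul, norm_mul _ ((t : ℂ) ^ k), norm_pow, Complex.norm_real,
      Real.norm_of_nonneg ht.1.le]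
    gcongr
    exact mul_le_of_le_one_right (norm_nonneg _) (pow_le_one₀ ht.1.le ht.2.le)
  have h := hasSum_integral_of_summable_integral_norm hF hnorm
  simp only [integral_const_mul, ← betaIntegral_eq_Ioo] at h
  convert! h using 1
  refine setIntegral_congr_fun measurableSet_Ioo fun t ht => ?_
  have hz : ‖(t : ℂ) / 2‖ < 1 := by
    rw [norm_div, Complex.norm_real, Real.norm_of_nonneg ht.1.le]
    norm_num
    linarith [ht.2]
  rw [← (hasSum_binomial a hz).tsum_eq, ← tsum_mul_left]
  refine tsum_congr fun k => ?_
  rw [hpt k t ht]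
  simp only [hc, div_pow, one_pow]
  ring

/-- Both sides evaluate `B(b/2, s)`: once by Gamma functions, once by the substitution and Euler's
integral. -/
lemma regHyp_gauss_of_re_pos {b s : ℂ} (hb : 0 < b.re) (hs : 0 < s.re) :
    Complex.Gamma b * regHyp (2 * s + b - 1) b (b + s) =
      (2 : ℂ) ^ (b - 1) * Complex.Gamma (b / 2) * (Complex.Gamma (b / 2 + s))⁻¹ := by
  have hb2 : 0 < (b / 2).re := by
    rw [Complex.div_ofNat_re]; positivity
  have h := hasSum_euler_integral (2 * s + b - 1) hb hs
  have hB : Complex.betaIntegral (b / 2) s = (2 : ℂ) ^ (1 - b) *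
      ∫ t in Set.Ioo (0 : ℝ) 1, (t : ℂ) ^ (b - 1) * (1 - (t : ℂ)) ^ (s - 1) *
        (1 - (t : ℂ) / 2) ^ (-(2 * s + b - 1)) := by
    rw [betaIntegral_eq_Ioo, integral_Ioo_subst_sq, ← MeasureTheory.integral_const_mul]
    exact MeasureTheory.setIntegral_congr_fun measurableSet_Ioo fun t ht => gauss_integrand_eq ht
  have hterm : ∀ k : ℕ, poch (2 * s + b - 1) k / k.factorial * (1 / 2) ^ k *
      Complex.betaIntegral (b + k) s =
        Complex.Gamma b * Complex.Gamma s * regTerm (2 * s + b - 1) b (b + s) k := by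
    intro k
    have hbk : 0 < (b + k).re := by simp; positivity
    rw [Complex.betaIntegral_eq_Gamma_mul_div _ _ hbk hs, Gamma_add_nat_eq hb, regTerm,
      add_right_comm b]
    simp only [div_eq_mul_inv]
    ring
  simp only [hterm] at h
  have h1 := h.tsum_eq
  rw [tsum_mul_left] at h1
  change Complex.Gamma b * Complex.Gamma s * regHyp _ _ _ = _ at h1
  have h2 : (2 : ℂ) ^ (b - 1) * (2 : ℂ) ^ (1 - b) = 1 := by
    rw [← Complex.cpow_add _ _ two_ne_zero]; simp
  have hs0 := Complex.Gamma_ne_zero_of_re_pos hs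
  rw [Complex.betaIntegral_eq_Gamma_mul_div _ _ hb2 hs, div_eq_mul_inv] at hB
  apply mul_left_cancel₀ hs0
  rw [← mul_assoc, mul_comm (Complex.Gamma s), h1]
  linear_combination (-(2 : ℂ) ^ (b - 1)) * hB - h2 * ∫ t in Set.Ioo (0 : ℝ) 1,
    (t : ℂ) ^ (b - 1) * (1 - (t : ℂ)) ^ (s - 1) * (1 - (t : ℂ) / 2) ^ (-(2 * s + b - 1))

/-- **Gauss's second summation theorem**, regularised. -/
lemma regHyp_gauss (a b : ℂ) : regHyp a b ((a + b + 1) / 2) =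
    (Real.sqrt Real.pi : ℂ) * (Complex.Gamma ((a + 1) / 2))⁻¹ * (Complex.Gamma ((b + 1) / 2))⁻¹ := by
  -- The recurrence and `1/Γ` acquire the same factor `(a + 1)/2`, so the formula descends from `a +
  -- 2` to `a`; no analytic continuation is needed.
  have hstep : ∀ a b : ℂ,
      (regHyp (a + 2) b ((a + 2 + b + 1) / 2) = (Real.sqrt Real.pi : ℂ) *
        (Complex.Gamma ((a + 2 + 1) / 2))⁻¹ * (Complex.Gamma ((b + 1) / 2))⁻¹) →
      regHyp a b ((a + b + 1) / 2) = (Real.sqrt Real.pi : ℂ) *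
        (Complex.Gamma ((a + 1) / 2))⁻¹ * (Complex.Gamma ((b + 1) / 2))⁻¹ := by
    intro a b h
    rw [regHyp_gauss_add_two (c := (a + b + 1) / 2) (by ring), inv_Gamma_eq ((a + 1) / 2)]
    rw [show (a + 1) / 2 + 1 = (a + 2 + 1) / 2 by ring,
      show (a + b + 1) / 2 + 1 = (a + 2 + b + 1) / 2 by ring, h]
    ring
  have hshift : ∀ (n : ℕ) (a b : ℂ),
      (regHyp (a + 2 * n) b ((a + 2 * n + b + 1) / 2) = (Real.sqrt Real.pi : ℂ) *
        (Complex.Gamma ((a + 2 * n + 1) / 2))⁻¹ * (Complex.Gamma ((b + 1) / 2))⁻¹) →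
      regHyp a b ((a + b + 1) / 2) = (Real.sqrt Real.pi : ℂ) *
        (Complex.Gamma ((a + 1) / 2))⁻¹ * (Complex.Gamma ((b + 1) / 2))⁻¹ := by
    intro n
    induction n with
    | zero => intro a b h; simpa using h
    | succ n ih =>
      intro a b h
      refine ih a b (hstep _ _ ?_)
      rwa [show a + 2 * ((n + 1 : ℕ) : ℂ) = a + 2 * n + 2 by push_cast; ring] at h
  have hbase : ∀ a b : ℂ, 0 < b.re → b.re < a.re →
      regHyp a b ((a + b + 1) / 2) = (Real.sqrt Real.pi : ℂ) *
        (Complex.Gamma ((a + 1) / 2))⁻¹ * (Complex.Gamma ((b + 1) / 2))⁻¹ := by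
    intro a b hb hab
    have hs : 0 < ((a - b + 1) / 2).re := by
      rw [Complex.div_ofNat_re]; simp; linarith
    have h := regHyp_gauss_of_re_pos hb hs
    rw [show 2 * ((a - b + 1) / 2) + b - 1 = a by ring,
      show b + (a - b + 1) / 2 = (a + b + 1) / 2 by ring,
      show b / 2 + (a - b + 1) / 2 = (a + 1) / 2 by ring] at h
    have hd := Complex.Gamma_mul_Gamma_add_half (b / 2)
    have h2 : (2 : ℂ) ^ (b - 1) * (2 : ℂ) ^ (1 - b) = 1 := by
      rw [← Complex.cpow_add _ _ two_ne_zero]; simp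
    rw [show b / 2 + 1 / 2 = (b + 1) / 2 by ring, show 2 * (b / 2) = b by ring] at hd
    have hb0 := Complex.Gamma_ne_zero_of_re_pos hb
    have hb1 : Complex.Gamma ((b + 1) / 2) ≠ 0 := Complex.Gamma_ne_zero_of_re_pos (by
      rw [Complex.div_ofNat_re]; simp; linarith)
    apply mul_left_cancel₀ hb0
    apply mul_right_cancel₀ hb1
    rw [h]
    set X := Complex.Gamma ((b + 1) / 2)
    have hX : X⁻¹ * X = 1 := inv_mul_cancel₀ hb1
    set Y := (Complex.Gamma ((a + 1) / 2))⁻¹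
    linear_combination (2 : ℂ) ^ (b - 1) * Y * hd + Complex.Gamma b * Real.sqrt Real.pi * Y * h2 -
      Complex.Gamma b * Real.sqrt Real.pi * Y * hX
  -- Raise `b` until its real part is positive, then `a` beyond it; symmetry lets the descent act on
  -- either parameter.
  obtain ⟨n, hn⟩ := exists_nat_gt (-b.re)
  obtain ⟨m, hm⟩ := exists_nat_gt ((b + 2 * n).re - a.re)
  have hn0 : (0 : ℝ) ≤ n := Nat.cast_nonneg n
  have hm0 : (0 : ℝ) ≤ m := Nat.cast_nonneg m
  have h1 : regHyp a (b + 2 * n) ((a + (b + 2 * n) + 1) / 2) = (Real.sqrt Real.pi : ℂ) *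
        (Complex.Gamma ((a + 1) / 2))⁻¹ * (Complex.Gamma ((b + 2 * n + 1) / 2))⁻¹ := by
    refine hshift m _ _ (hbase _ _ ?_ ?_)
    · simp; linarith
    · simp at hm ⊢; linarith
  rw [regHyp_comm, add_comm a b, mul_right_comm]
  refine hshift n _ _ ?_
  rw [regHyp_comm, add_comm _ a, h1, mul_right_comm]

/-! ### Lower parameter shifted by half-integers -/

lemma regHyp_sub_mul (a b c : ℂ) : (c - b) * regHyp (a + 1) b (c + 1) =
    regHyp a b c - b / 2 * regHyp (a + 1) (b + 1) (c + 1) := by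
  linear_combination regHyp_mul_sub (a + 1) b c + regHyp_sub_lower a b c

/-- The finite sums of Gamma quotients in the generalised Gauss second theorem. -/
noncomputable def gammaSum (σ : ℂ) (i : ℕ) (a b : ℂ) : ℂ :=
  ∑ r ∈ Finset.range (i + 1), σ ^ r * (i.choose r : ℂ) *
    (Complex.Gamma ((b + r) / 2) / Complex.Gamma ((a + r + 1 - i) / 2))

/-- Pascal's rule; `σ = 1` and `σ = -1` match `regHyp_sub_lower` and `regHyp_sub_mul`. -/
lemma gammaSum_succ (σ : ℂ) (i : ℕ) (a b : ℂ) :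
    gammaSum σ (i + 1) (a + 1) b = gammaSum σ i a b + σ * gammaSum σ i (a + 1) (b + 1) := by
  have h := Finset.sum_choose_succ_mul (R := ℂ) (fun r _ => σ ^ r *
    (Complex.Gamma ((b + r) / 2) / Complex.Gamma ((a + r + 1 - i) / 2))) i
  simp only [gammaSum, Finset.mul_sum]
  calc _ = _ := Finset.sum_congr rfl fun r _ => ?_
    _ = _ := h
    _ = _ := congrArg₂ _ (Finset.sum_congr rfl fun r _ => ?_) (Finset.sum_congr rfl fun r _ => ?_)
  · push_cast
    rw [show a + 1 + r + 1 - (i + 1) = a + r + 1 - i by ring]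
    ring
  · ring
  · push_cast
    rw [show b + (r + 1) = b + 1 + r by ring, show a + (r + 1) + 1 - i = a + 1 + r + 1 - i by ring]
    ring

lemma sqrt_pi_mul_inv_Gamma {b : ℂ} (hb : NotNonposInt (b / 2)) :
    (Real.sqrt Real.pi : ℂ) * (Complex.Gamma ((b + 1) / 2))⁻¹ =
      2 ^ (b - 1) * (Complex.Gamma b)⁻¹ * Complex.Gamma (b / 2) := by
  have hd := Complex.Gamma_mul_Gamma_add_half (b / 2)
  rw [show b / 2 + 1 / 2 = (b + 1) / 2 by ring, show 2 * (b / 2) = b by ring] at hd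
  have h2 : (2 : ℂ) ^ (b - 1) * (2 : ℂ) ^ (1 - b) = 1 := by
    rw [← Complex.cpow_add _ _ two_ne_zero]; simp
  have hπ : (Real.sqrt Real.pi : ℂ) ≠ 0 := by
    exact_mod_cast (Real.sqrt_pos.2 Real.pi_pos).ne'
  -- `Γ` takes the value `0` at its poles. If `b` is one, duplication forces `(b + 1)/2` to be one
  -- too, and both sides vanish.
  by_cases h0 : Complex.Gamma b = 0
  · have : Complex.Gamma ((b + 1) / 2) = 0 := by
      rw [h0, zero_mul, zero_mul] at hd
      exact (mul_eq_zero.1 hd).resolve_left hb.Gamma_ne_zero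
    simp [h0, this]
  · have h1 : Complex.Gamma ((b + 1) / 2) ≠ 0 := by
      intro h1
      rw [h1, mul_zero] at hd
      exact mul_ne_zero (mul_ne_zero h0 (right_ne_zero_of_mul_eq_one h2)) hπ hd.symm
    field_simp
    linear_combination (-(2 : ℂ) ^ (b - 1)) * hd - Complex.Gamma b * Real.sqrt Real.pi * h2

lemma regHyp_gauss' {a b : ℂ} (hb : NotNonposInt (b / 2)) :
    regHyp a b ((a + b + 1) / 2) = 2 ^ (b - 1) * (Complex.Gamma b)⁻¹ *
      (Complex.Gamma (b / 2) / Complex.Gamma ((a + 1) / 2)) := by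
  rw [regHyp_gauss, mul_right_comm, sqrt_pi_mul_inv_Gamma hb, mul_assoc,
    div_eq_mul_inv (Complex.Gamma (b / 2))]

/-- The prefactor `2^(b-1) / Γ(b)` absorbs the `b / 2` of the contiguous relations. -/
lemma half_mul_two_cpow_div_Gamma (b : ℂ) :
    b / 2 * ((2 : ℂ) ^ (b + 1 - 1) * (Complex.Gamma (b + 1))⁻¹) =
      2 ^ (b - 1) * (Complex.Gamma b)⁻¹ := by
  rw [inv_Gamma_eq b, show b + 1 - 1 = b - 1 + 1 by ring, Complex.cpow_add _ _ two_ne_zero,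
    Complex.cpow_one]
  ring

lemma regHyp_gauss_sub (i : ℕ) (a b : ℂ) (hb : ∀ r ≤ i, NotNonposInt ((b + r) / 2)) :
    regHyp a b ((a + b + 1 - i) / 2) =
      2 ^ (b - 1) * (Complex.Gamma b)⁻¹ * gammaSum 1 i a b := by
  induction i generalizing a b with
  | zero =>
    have := hb 0 le_rfl
    simp only [gammaSum, Nat.cast_zero, add_zero] at this ⊢
    simp [regHyp_gauss' this]
  | succ i ih =>
    obtain ⟨a, rfl⟩ : ∃ a', a = a' + 1 := ⟨a - 1, by ring⟩
    rw [gammaSum_succ, one_mul, mul_add, ← ih a b fun r hr => hb r (hr.trans i.le_succ),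
      ← half_mul_two_cpow_div_Gamma, mul_assoc (b / 2), ← ih (a + 1) (b + 1) fun r hr => by
        simpa [add_assoc, add_comm, add_left_comm] using hb (r + 1) (Nat.succ_le_succ hr)]
    push_cast
    rw [show (a + 1 + b + 1 - (i + 1)) / 2 = (a + b + 1 - i) / 2 by ring,
      show (a + 1 + (b + 1) + 1 - i) / 2 = (a + b + 1 - i) / 2 + 1 by ring]
    linear_combination regHyp_sub_lower a b ((a + b + 1 - i) / 2)

lemma regHyp_gauss_add (i : ℕ) (a b : ℂ) (hab : NotNonposInt ((a - b + 1 - i) / 2))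
    (hb : ∀ r ≤ i, NotNonposInt ((b + r) / 2)) :
    regHyp a b ((a + b + 1 + i) / 2) = 2 ^ (b - 1) * (Complex.Gamma b)⁻¹ *
      (Complex.Gamma ((a - b + 1 - i) / 2) / Complex.Gamma ((a - b + 1 + i) / 2)) *
        gammaSum (-1) i a b := by
  induction i generalizing a b with
  | zero =>
    have := hb 0 le_rfl
    simp only [gammaSum, Nat.cast_zero, add_zero, sub_zero] at this hab ⊢
    simp [regHyp_gauss' this, hab.Gamma_ne_zero]
  | succ i ih =>
    obtain ⟨a, rfl⟩ : ∃ a', a = a' + 1 := ⟨a - 1, by ring⟩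
    push_cast at hab
    rw [show (a + 1 - b + 1 - (i + 1)) / 2 = (a - b + 1 - i) / 2 by ring] at hab
    have h1 := ih a b hab fun r hr => hb r (hr.trans i.le_succ)
    have h2 := ih (a + 1) (b + 1) (by rwa [add_sub_add_right_eq_sub]) fun r hr => by
        simpa [add_assoc, add_comm, add_left_comm] using hb (r + 1) (Nat.succ_le_succ hr)
    rw [add_sub_add_right_eq_sub] at h2
    -- This is the factor `c - b` in `regHyp_sub_mul`; dividing by it extends the Gamma quotient by
    -- one step.
    have hp : (a - b + 1 + i) / 2 ≠ 0 := by
      have := hab.add_nat_ne_zero i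
      rwa [show (a - b + 1 - i) / 2 + i = (a - b + 1 + i) / 2 by ring] at this
    have hrec := regHyp_sub_mul a b ((a + b + 1 + i) / 2)
    rw [show (a + b + 1 + i) / 2 + 1 = (a + 1 + (b + 1) + 1 + i) / 2 by ring, h1, h2,
      show (a + b + 1 + i) / 2 - b = (a - b + 1 + i) / 2 by ring] at hrec
    push_cast
    rw [gammaSum_succ, show (a + 1 + b + 1 + (i + 1)) / 2 = (a + 1 + (b + 1) + 1 + i) / 2 by ring,
      show (a + 1 - b + 1 - (i + 1)) / 2 = (a - b + 1 - i) / 2 by ring,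
      show (a + 1 - b + 1 + (i + 1)) / 2 = (a - b + 1 + i) / 2 + 1 by ring,
      Complex.Gamma_add_one _ hp]
    apply mul_left_cancel₀ hp
    rw [hrec, ← half_mul_two_cpow_div_Gamma]
    have hp' := mul_inv_cancel₀ hp
    simp only [div_eq_mul_inv _ (Complex.Gamma _), div_eq_mul_inv _ (_ * Complex.Gamma _), mul_inv]
    linear_combination (-(b / 2 * (2 ^ (b + 1 - 1) * (Complex.Gamma (b + 1))⁻¹) *
      (Complex.Gamma ((a - b + 1 - i) / 2) * (Complex.Gamma ((a - b + 1 + i) / 2))⁻¹) *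
        (gammaSum (-1) i a b - gammaSum (-1) i (a + 1) (b + 1)))) * hp'

/-! ### The two summation formulas -/

theorem theorem2 (i : ℕ) (α β ε : ℂ) (hβ : NotNonposInt β) :
    (NotNonposInt (1 + α - β + ε + i) →
      Summable (fun p : ℕ × ℕ =>
        kampeDeFerietTerm [α] [ε] [β - ε, 1 + α - 2 * β + ε + i]
          [β] [] [1 + α - β + ε + i] (1 / 2) (1 / 2) p.1 p.2) ∧
      (NotNonposInt (β - ε - i) →
        (∀ r ∈ Finset.range (i + 1), NotNonposInt (ε - β + (1 + α + i + r) / 2)) →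
        kampeDeFeriet [α] [ε] [β - ε, 1 + α - 2 * β + ε + i]
            [β] [] [1 + α - β + ε + i] (1 / 2) (1 / 2) =
          ((2 : ℂ) ^ ((i : ℂ) + α - 2 * β + 2 * ε) *
              Complex.Gamma (β - ε - i) * Complex.Gamma (1 + α - β + ε + i)) /
            (Complex.Gamma (β - ε) * Complex.Gamma (1 + α - 2 * β + 2 * ε + i)) *
          ∑ r ∈ Finset.range (i + 1), (-1 : ℂ) ^ r * (i.choose r : ℂ) *
            (Complex.Gamma (ε - β + (1 + α + i + r) / 2) /
              Complex.Gamma ((1 + α - i + r) / 2)))) ∧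
    (NotNonposInt (1 + α - β + ε - i) →
      Summable (fun p : ℕ × ℕ =>
        kampeDeFerietTerm [α] [ε] [β - ε, 1 + α - 2 * β + ε - i]
          [β] [] [1 + α - β + ε - i] (1 / 2) (1 / 2) p.1 p.2) ∧
      ((∀ r ∈ Finset.range (i + 1), NotNonposInt (ε - β + (1 + α - i + r) / 2)) →
        kampeDeFeriet [α] [ε] [β - ε, 1 + α - 2 * β + ε - i]
            [β] [] [1 + α - β + ε - i] (1 / 2) (1 / 2) =
          ((2 : ℂ) ^ (-(i : ℂ) + α - 2 * β + 2 * ε) *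
              Complex.Gamma (1 + α - β + ε - i)) /
            Complex.Gamma (1 + α - 2 * β + 2 * ε - i) *
          ∑ r ∈ Finset.range (i + 1), (i.choose r : ℂ) *
            (Complex.Gamma (ε - β + (1 + α - i + r) / 2) /
              Complex.Gamma ((1 + α - i + r) / 2)))) := by
  refine ⟨fun hd => ⟨summable_kampeDeFerietTerm .., fun hG hr => ?_⟩,
    fun hd => ⟨summable_kampeDeFerietTerm .., fun hr => ?_⟩⟩
  · rw [kampeDeFeriet_eq_regHyp hβ hd (by ring)]
    -- With this `b` the lower parameter is exactly `(α + b + 1 + i) / 2`.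
    set b : ℂ := 1 + α - 2 * β + 2 * ε + i with hb
    have hbr : ∀ r : ℕ, ε - β + (1 + α + i + r) / 2 = (b + r) / 2 := fun r => by rw [hb]; ring
    have h1 : (α - b + 1 - i) / 2 = β - ε - i := by rw [hb]; ring
    have h := regHyp_gauss_add i α b (by rwa [h1]) fun r hri => by
      rw [← hbr]; exact hr r (Finset.mem_range.2 (Nat.lt_succ_of_le hri))
    rw [h1, show (α - b + 1 + i) / 2 = β - ε by rw [hb]; ring,
      show (α + b + 1 + i) / 2 = 1 + α - β + ε + i by rw [hb]; ring, gammaSum] at h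
    rw [show 1 + α - 2 * β + ε + i + ε = b by rw [hb]; ring, h,
      show (i : ℂ) + α - 2 * β + 2 * ε = b - 1 by rw [hb]; ring]
    simp only [hbr, show ∀ r : ℕ, 1 + α - i + r = α + r + 1 - i from fun r => by ring]
    simp only [div_eq_mul_inv _ (Complex.Gamma _ * Complex.Gamma _),
      div_eq_mul_inv (Complex.Gamma (β - ε - i)), mul_inv]
    ring
  · rw [kampeDeFeriet_eq_regHyp hβ hd (by ring)]
    set b : ℂ := 1 + α - 2 * β + 2 * ε - i with hb
    have hbr : ∀ r : ℕ, ε - β + (1 + α - i + r) / 2 = (b + r) / 2 := fun r => by rw [hb]; ring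
    have h := regHyp_gauss_sub i α b fun r hri => by
      rw [← hbr]; exact hr r (Finset.mem_range.2 (Nat.lt_succ_of_le hri))
    rw [show (α + b + 1 - i) / 2 = 1 + α - β + ε - i by rw [hb]; ring, gammaSum] at h
    rw [show 1 + α - 2 * β + ε - i + ε = b by rw [hb]; ring, h,
      show -(i : ℂ) + α - 2 * β + 2 * ε = b - 1 by rw [hb]; ring]
    simp only [hbr]
    simp only [show ∀ r : ℕ, 1 + α - i + r = α + r + 1 - i from fun r => by ring, one_pow, one_mul]
    simp only [div_eq_mul_inv _ (Complex.Gamma b)]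
    ring
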